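/- Work in formal power series in $z$ over $\mathbb{Q}[t][[x_1,x_2,\dots]]$. For a finite digraph $\overrightarrow{G}=(V,E)$ let $$X_{\overrightarrow{G}}(\mathbf{x},t)=\sum_{\kappa}t^{\mathrm{asc}(\kappa)}\prod_{v\in V}x_{\kappa(v)},$$ where $\kappa$ ranges over all proper colorings $\kappa:V\to\{1,2,3,\dots\}$ of the underlying undirected graph of $\overrightarrow{G}$, and $\mathrm{asc}(\kappa)$ is the number of directed edges $(u,v)\in E$ with $\kappa(u)<\kappa(v)$. For $n\ge 2$ let $\overrightarrow{C_n}$ be the directed cycle with vertices $v_1,\dots,v_n$ and edges $(v_i,v_{i+1})$ for $1\le i<n$ together with $(v_n,v_1)$. Let $e_k=e_k(\mathbf{x})$ be the $k$-th elementary symmetric function in $x_1,x_2,\dots$ and let $[n]_t=1+t+\cdots+t^{n-1}$. **Theorem.** $$\sum_{n\ge2}X_{\overrightarrow{C_n}}(\mathbf{x},t)\,z^n=\frac{t\sum_{k\ge2}k\,[k-1]_t\,e_k(\mathbf{x})\,z^k}{1-t\sum_{k\ge2}[k-1]_t\,e_k(\mathbf{x})\,z^k},$$ where the denominator is an invertible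 formal power series. -/

import Mathlib

open Polynomial

noncomputable section

namespace ChromQSym

/-- A coloring of the vertices of a digraph by positive integers is proper if it is a proper
coloring of the underlying undirected graph. -/
def IsProper {V : Type} (G : Digraph V) (κ : V → ℕ+) : Prop :=
  ∀ u v : V, G.toSimpleGraphInclusive.Adj u v → κ u ≠ κ v

open Classical in
/-- The number of directed edges `(u, v)` with `κ u < κ v`. -/
def asc {V : Type} [Fintype V] (G : Digraph V) (κ : V → ℕ+) : ℕ :=
  (Finset.univ.filter fun e : V × V => G.Adj e.1 e.2 ∧ κ e.1 < κ e.2).card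

/-- The exponent vector of the monomial `x_κ = ∏ v, x_{κ v}`. -/
def monoExp {V : Type} [Fintype V] (κ : V → ℕ+) : ℕ+ →₀ ℕ :=
  ∑ v : V, Finsupp.single (κ v) 1

open Classical in
/-- The finite set of the proper colorings `κ` of `G` with `x_κ = x^m`. Such a coloring only uses
colors from the support of `m`; see `mem_properColorings`. -/
def properColorings {V : Type} [Fintype V] (G : Digraph V) (m : ℕ+ →₀ ℕ) : Finset (V → ℕ+) :=
  (Fintype.piFinset fun _ : V => m.support).filter fun κ => IsProper G κ ∧ monoExp κ = m

theorem mem_properColorings {V : Type} [Fintype V] (G : Digraph V) (m : ℕ+ →₀ ℕ) (κ : V → ℕ+) :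
    κ ∈ properColorings G m ↔ IsProper G κ ∧ monoExp κ = m := by
  classical
  simp only [properColorings, Finset.mem_filter, Fintype.mem_piFinset, and_iff_right_iff_imp]
  rintro ⟨-, rfl⟩ v
  rw [Finsupp.mem_support_iff, monoExp, Finsupp.finsetSum_apply]
  intro h
  have := (Finset.sum_eq_zero_iff.mp h) v (Finset.mem_univ v)
  simp at this

/-- The chromatic quasisymmetric function `X_G(x, t) = ∑_κ t^{asc κ} x_κ`, summed over all proper
colorings `κ : V → {1, 2, 3, …}`, as a formal power series in `x₁, x₂, …` with coefficients in
`ℚ[t]`: the coefficient of `x^m` is the sum of `t^{asc κ}` over the finitely many `κ` with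
`x_κ = x^m`. The variable `t` is `Polynomial.X`. -/
def chromQSym {V : Type} [Fintype V] (G : Digraph V) : MvPowerSeries ℕ+ ℚ[X] :=
  fun m => ∑ κ ∈ properColorings G m, (X : ℚ[X]) ^ asc G κ

open Classical in
/-- The elementary symmetric function `e_k(x₁, x₂, …) = ∑_{|S| = k} ∏_{i ∈ S} x_i`: distinct sets
`S` give distinct monomials, so every coefficient is `1` or `0`. -/
def esymm (k : ℕ) : MvPowerSeries ℕ+ ℚ[X] :=
  fun m => if ∃ S : Finset ℕ+, S.card = k ∧ m = ∑ i ∈ S, Finsupp.single i 1 then 1 else 0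

/-- The variable `t`, as a constant of `ℚ[t]⟦x₁, x₂, …⟧`. -/
def tVar : MvPowerSeries ℕ+ ℚ[X] := MvPowerSeries.C (X : ℚ[X])

/-- `[n]_t = 1 + t + ⋯ + t^{n-1}`. -/
def tInt (n : ℕ) : MvPowerSeries ℕ+ ℚ[X] := ∑ i ∈ Finset.range n, tVar ^ i

/-- The directed cycle on the vertices `0, …, n - 1`, with the edges `(i, i + 1)` for
`i + 1 < n` and the edge `(n - 1, 0)`. -/
def directedCycle (n : ℕ) : Digraph (Fin n) where
  Adj i j := i.val + 1 = j.val ∨ (i.val + 1 = n ∧ j.val = 0)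

/-- `∑_{n ≥ 2} a_n z^n`, a power series in `z` over `ℚ[t]⟦x₁, x₂, …⟧`. -/
def genFrom2 (a : ℕ → MvPowerSeries ℕ+ ℚ[X]) : PowerSeries (MvPowerSeries ℕ+ ℚ[X]) :=
  PowerSeries.mk fun n => if 2 ≤ n then a n else 0

end ChromQSym

end

/-!
Set all variables outside a finite set of colors to zero. A proper coloring of the directed
`n`-cycle is then a closed walk of length `n` on the colors, so `X_{C_n}` becomes the trace of
`Mⁿ`, where `M` has the entries `M i j = t x_j`, `0`, `x_j` for `i < j`, `i = j`, `j < i`. By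
Jacobi's formula `∑ tr (Mⁿ) zⁿ = - z D' / D` with `D = det (1 - z M)`. Let `P` be the rank-one
matrix with entries `x_j`: since `1 - z M + s P` has a determinant affine in `s` and is triangular
for `s = z` and for `s = t z`, one finds `(t - 1) D = t ∏ (1 + x_j z) - ∏ (1 + t x_j z)`, whose
coefficients give `D = 1 - t ∑_{k ≥ 2} [k-1]_t e_k z^k`. A power series is determined by its
restrictions to finitely many variables.
-/

section Determinants

variable {R A ι : Type*} [CommRing R] [CommRing A] [Algebra R A] [DecidableEq ι]

theorem derivation_prod (D : Derivation R A A) (s : Finset ι) (f : ι → A) :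
    D (∏ i ∈ s, f i) = ∑ i ∈ s, D (f i) * ∏ j ∈ s.erase i, f j := by
  induction s using Finset.induction_on with
  | empty => simp
  | insert a s ha ih =>
    rw [Finset.prod_insert ha, D.leibniz, ih, Finset.sum_insert ha, Finset.erase_insert ha,
      smul_eq_mul, smul_eq_mul, Finset.mul_sum, mul_comm (∏ i ∈ s, f i), add_comm]
    refine congrArg _ (Finset.sum_congr rfl fun i hi => ?_)
    rw [Finset.erase_insert_of_ne (ne_of_mem_of_not_mem hi ha).symm,
      Finset.prod_insert (mt Finset.mem_of_mem_erase ha), mul_left_comm]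

theorem derivation_det_eq_sum_updateCol [Fintype ι] (D : Derivation R A A) (M : Matrix ι ι A) :
    D M.det = ∑ i, (M.updateCol i fun j => D (M j i)).det := by
  simp only [Matrix.det_apply', map_sum]
  rw [Finset.sum_comm]
  refine Finset.sum_congr rfl fun σ _ => ?_
  rw [D.leibniz, Derivation.map_intCast, smul_zero, add_zero, smul_eq_mul, derivation_prod,
    Finset.mul_sum]
  refine Finset.sum_congr rfl fun i _ => ?_
  rw [← Finset.mul_prod_erase _ _ (Finset.mem_univ i), Matrix.updateCol_self]
  congr 2
  refine Finset.prod_congr rfl fun j hj => ?_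
  rw [Matrix.updateCol_ne (Finset.ne_of_mem_erase hj)]

/-- **Jacobi's formula** for the derivative of a determinant. -/
theorem derivation_det [Fintype ι] (D : Derivation R A A) (M : Matrix ι ι A) :
    D M.det = (M.adjugate * M.map D).trace := by
  rw [derivation_det_eq_sum_updateCol]
  refine Finset.sum_congr rfl fun i _ => ?_
  rw [← Matrix.cramer_apply, Matrix.cramer_eq_adjugate_mulVec]
  rfl

theorem exists_det_add_smul_vecMulVec [Fintype ι] (M : Matrix ι ι R) (u v : ι → R) :
    ∃ c, ∀ s : R, (M + s • Matrix.vecMulVec u v).det = M.det + s * c := by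
  -- Bordering `M` by one row and one column confines `s` to a single column.
  let B : Matrix (ι ⊕ Unit) (ι ⊕ Unit) R :=
    Matrix.fromBlocks M 0 (-Matrix.replicateRow Unit v) 1
  let border (s : R) : Matrix (ι ⊕ Unit) (ι ⊕ Unit) R :=
    B.updateCol (Sum.inr ()) (s • Sum.elim u (fun _ => 0) + Sum.elim (fun _ => 0) fun _ => 1)
  refine ⟨(B.updateCol (Sum.inr ()) (Sum.elim u fun _ => 0)).det, fun s => ?_⟩
  have hblocks : border s =
      Matrix.fromBlocks M (Matrix.replicateCol Unit (s • u)) (-Matrix.replicateRow Unit v) 1 := by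
    ext (i | i) (j | j) <;> simp [border, B]
  have hborder : (border s).det = (M + s • Matrix.vecMulVec u v).det := by
    rw [hblocks, Matrix.det_fromBlocks_one₂₂, Matrix.mul_neg, sub_neg_eq_add,
      ← Matrix.vecMulVec_eq, Matrix.smul_vecMulVec]
  have hzero : B.updateCol (Sum.inr ()) (Sum.elim (fun _ => 0) fun _ => 1) = B := by
    ext (i | i) (j | j) <;> simp [B]
  rw [← hborder, Matrix.det_updateCol_add, Matrix.det_updateCol_smul, hzero,
    Matrix.det_fromBlocks_zero₁₂, Matrix.det_one, mul_one, add_comm]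

end Determinants

section TracePowers

open scoped PowerSeries

theorem map_derivative {R S : Type*} [CommSemiring R] [CommSemiring S] (f : R →+* S) (p : R⟦X⟧) :
    PowerSeries.map f (d⁄dX R p) = d⁄dX S (PowerSeries.map f p) := by
  ext n
  simp [PowerSeries.coeff_derivative]

theorem charpolyRev_map {R S ι : Type*} [CommRing R] [CommRing S] [DecidableEq ι] [Fintype ι]
    (f : R →+* S) (M : Matrix ι ι R) : (M.map f).charpolyRev = M.charpolyRev.map f := by
  rw [Matrix.charpolyRev, Matrix.charpolyRev, ← coe_mapRingHom, RingHom.map_det]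
  congr 1
  ext1 i j
  by_cases h : i = j <;> simp [h]

variable {R ι : Type*} [CommRing R] [DecidableEq ι] [Fintype ι]

/-- The geometric series `∑ Mⁿ zⁿ` of a square matrix `M`, as a matrix of power series in `z`. -/
noncomputable def matrixGeomSeries (M : Matrix ι ι R) : Matrix ι ι R⟦X⟧ :=
  Matrix.of fun i j => PowerSeries.mk fun n => (M ^ n) i j

theorem coeff_matrixGeomSeries_mul_map_C (M N : Matrix ι ι R) (i j : ι) (n : ℕ) :
    PowerSeries.coeff n ((matrixGeomSeries M * N.map PowerSeries.C) i j) = (M ^ n * N) i j := by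
  simp [matrixGeomSeries, Matrix.mul_apply]

theorem matrixGeomSeries_mul_one_sub (M : Matrix ι ι R) :
    matrixGeomSeries M * (1 - (PowerSeries.X : R⟦X⟧) • M.map PowerSeries.C) = 1 := by
  ext i j n
  rw [mul_sub, mul_one, Matrix.mul_smul, Matrix.sub_apply, Matrix.smul_apply, smul_eq_mul, map_sub]
  have hone : (1 : Matrix ι ι R⟦X⟧) i j = PowerSeries.C ((1 : Matrix ι ι R) i j) := by
    rw [← Matrix.map_one PowerSeries.C (map_zero _) (map_one _), Matrix.map_apply]
  cases n with
  | zero => simp [hone, matrixGeomSeries]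
  | succ n =>
    rw [PowerSeries.coeff_succ_X_mul, coeff_matrixGeomSeries_mul_map_C, ← pow_succ, hone,
      PowerSeries.coeff_succ_C]
    simp [matrixGeomSeries]

theorem coe_charpolyRev (M : Matrix ι ι R) :
    (M.charpolyRev : R⟦X⟧) = (1 - (PowerSeries.X : R⟦X⟧) • M.map PowerSeries.C).det := by
  rw [Matrix.charpolyRev, ← Polynomial.coeToPowerSeries.ringHom_apply, RingHom.map_det]
  congr 1
  ext1 i j
  by_cases h : i = j <;> simp [h, PowerSeries.X_mul]

/-- As `charpolyRev M = det (1 - z M)`, this says that `∑ tr (Mⁿ⁺¹) zⁿ` is minus the logarithmic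
derivative of `det (1 - z M)`. -/
theorem mk_trace_pow_succ_mul_charpolyRev (M : Matrix ι ι R) :
    (PowerSeries.mk fun n => (M ^ (n + 1)).trace) * (M.charpolyRev : R⟦X⟧) =
      -d⁄dX R (M.charpolyRev : R⟦X⟧) := by
  set A : Matrix ι ι R⟦X⟧ := 1 - (PowerSeries.X : R⟦X⟧) • M.map PowerSeries.C with hA
  have hadj : A.adjugate = A.det • matrixGeomSeries M := by
    calc A.adjugate = matrixGeomSeries M * A * A.adjugate := by
          rw [matrixGeomSeries_mul_one_sub, one_mul]
      _ = A.det • matrixGeomSeries M := by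
          rw [mul_assoc, Matrix.mul_adjugate, Matrix.mul_smul, mul_one]
  have hderiv : A.map (d⁄dX R) = -M.map PowerSeries.C := by
    ext1 i j
    by_cases h : i = j <;> simp [hA, h, Derivation.leibniz]
  have htrace : (PowerSeries.mk fun n => (M ^ (n + 1)).trace) =
      (matrixGeomSeries M * M.map PowerSeries.C).trace := by
    ext n
    simp only [PowerSeries.coeff_mk, Matrix.trace, Matrix.diag_apply, map_sum,
      coeff_matrixGeomSeries_mul_map_C, pow_succ]
  rw [coe_charpolyRev, derivation_det, hadj, hderiv, htrace, Matrix.mul_neg, Matrix.trace_neg,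
    neg_neg, Matrix.smul_mul, Matrix.trace_smul, smul_eq_mul, mul_comm]

end TracePowers

section ClosedWalks

variable {R ι : Type*} [CommSemiring R]

/-- The weight, under a matrix `M` of edge weights, of the walk that visits `w 0, …, w n`. -/
def walkWeight {n : ℕ} (M : Matrix ι ι R) (w : Fin (n + 1) → ι) : R :=
  ∏ i : Fin n, M (w i.castSucc) (w i.succ)

theorem walkWeight_vecCons {n : ℕ} (M : Matrix ι ι R) (a : ι) (w : Fin (n + 1) → ι) :
    walkWeight M (Matrix.vecCons a w) = M a (w 0) * walkWeight M w :=
  Fin.prod_univ_succ _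

variable [Fintype ι]

theorem sum_fin_succ_eq_sum_vecCons {n : ℕ} (f : (Fin (n + 1) → ι) → R) :
    ∑ w, f w = ∑ a, ∑ w : Fin n → ι, f (Matrix.vecCons a w) := by
  rw [← (Fin.consEquiv fun _ => ι).sum_comp, Fintype.sum_prod_type]
  rfl

variable [DecidableEq ι]

theorem pow_mul_apply_eq_sum_walkWeight (M N : Matrix ι ι R) (n : ℕ) (a b : ι) :
    (M ^ n * N) a b = ∑ w : Fin n → ι,
      walkWeight M (Matrix.vecCons a w) * N (Matrix.vecCons a w (Fin.last n)) b := by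
  induction n generalizing a with
  | zero => simp [walkWeight]
  | succ n ih =>
    rw [pow_succ', mul_assoc, Matrix.mul_apply, sum_fin_succ_eq_sum_vecCons]
    refine Finset.sum_congr rfl fun c _ => ?_
    rw [ih, Finset.mul_sum]
    refine Finset.sum_congr rfl fun w _ => ?_
    rw [walkWeight_vecCons M a, ← mul_assoc]
    rfl

theorem trace_pow_succ_eq_sum_closed_walks (M : Matrix ι ι R) (n : ℕ) :
    (M ^ (n + 1)).trace = ∑ w : Fin (n + 1) → ι, ∏ i, M (w i) (w (i + 1)) := by
  rw [sum_fin_succ_eq_sum_vecCons, Matrix.trace]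
  refine Finset.sum_congr rfl fun a _ => ?_
  rw [Matrix.diag_apply, pow_succ, pow_mul_apply_eq_sum_walkWeight]
  refine Finset.sum_congr rfl fun w _ => ?_
  simp [walkWeight, Fin.prod_univ_castSucc, Fin.coeSucc_eq_succ]

end ClosedWalks

section AscentMatrix

theorem coeff_prod_one_add_C_mul_X {R ι : Type*} [CommSemiring R] (s : Finset ι) (x : ι → R)
    (k : ℕ) : (∏ i ∈ s, (1 + C (x i) * X)).coeff k = (s.val.map x).esymm k := by
  simp only [Finset.prod_one_add, Finset.prod_mul_distrib, Finset.prod_const, ← map_prod,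
    finsetSum_coeff, coeff_C_mul_X_pow]
  rw [← Finset.sum_filter, Finset.esymm_map_val, Finset.powersetCard_eq_filter]
  simp only [eq_comm]

variable {R ι : Type*} [LinearOrder ι]

section Semiring

variable [Semiring R]

/-- The weights of the steps of a coloring of a cycle: a step into `j` has weight `x j`, times `t`
if it is an ascent, and a constant step is forbidden. -/
def ascMatrix (t : R) (x : ι → R) : Matrix ι ι R :=
  Matrix.of fun i j => x j * if i < j then t else if j < i then 1 else 0

theorem map_ascMatrix {S : Type*} [Semiring S] (f : R →+* S) (t : R) (x : ι → R) :
    (ascMatrix t x).map f = ascMatrix (f t) (f ∘ x) := by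
  ext i j
  simp [ascMatrix, apply_ite f]

end Semiring

variable [CommRing R] [Fintype ι] [DecidableEq ι]

theorem sub_one_mul_charpolyRev_ascMatrix (t : R) (x : ι → R) :
    (C t - 1) * (ascMatrix t x).charpolyRev =
      C t * ∏ j, (1 + C (x j) * X) - ∏ j, (1 + C (t * x j) * X) := by
  set A : Matrix ι ι R[X] := 1 - (X : R[X]) • (ascMatrix t x).map C with hA
  set P := Matrix.vecMulVec (1 : ι → R[X]) fun j => C (x j) with hP
  -- Adding `X • P` cancels the entries below the diagonal, adding `(C t * X) • P` those above it.
  have hupper : (A + (X : R[X]) • P).det = ∏ j, (1 + C (x j) * X) := by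
    rw [Matrix.det_of_isUpperTriangular]
    · refine Finset.prod_congr rfl fun j _ => ?_
      simp [hA, hP, ascMatrix, X_mul_C]
    · intro i j hij
      have hij : j < i := hij
      simp [hA, hP, ascMatrix, hij, hij.not_gt, hij.ne']
  have hlower : (A + (C t * X) • P).det = ∏ j, (1 + C (t * x j) * X) := by
    rw [Matrix.det_of_isLowerTriangular]
    · refine Finset.prod_congr rfl fun j _ => ?_
      simp [hA, hP, ascMatrix, mul_assoc, X_mul_C]
    · intro i j hij
      have hij : i < j := hij
      suffices -(X * (C (x j) * C t)) + C t * X * C (x j) = 0 by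
        simpa [hA, hP, ascMatrix, hij, hij.ne]
      ring
  obtain ⟨c, hc⟩ := exists_det_add_smul_vecMulVec A 1 fun j => C (x j)
  rw [← hupper, ← hlower, hc, hc, Matrix.charpolyRev]
  ring

theorem sub_one_mul_coeff_charpolyRev_ascMatrix (t : R) (x : ι → R) (k : ℕ) :
    (t - 1) * (ascMatrix t x).charpolyRev.coeff k =
      (t - t ^ k) * (Finset.univ.val.map x).esymm k := by
  have h := congrArg (coeff · k) (sub_one_mul_charpolyRev_ascMatrix t x)
  rw [← C_1, ← C_sub] at h
  simp only [C_1, coeff_C_mul, coeff_sub, coeff_prod_one_add_C_mul_X] at h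
  have hscale := Multiset.pow_smul_esymm t k (Finset.univ.val.map x)
  simp only [Multiset.map_map, Function.comp_def, smul_eq_mul] at hscale
  rw [h, ← hscale, sub_mul]

theorem coeff_succ_charpolyRev_ascMatrix (t : R) (x : ι → R) (k : ℕ) :
    (ascMatrix t x).charpolyRev.coeff (k + 1) =
      -(t * (∑ i ∈ Finset.range k, t ^ i) * (Finset.univ.val.map x).esymm (k + 1)) := by
  -- For a generic parameter `X` in place of `t` the factor `X - 1` can be cancelled.
  have hgeneric : (ascMatrix (X : R[X]) (C ∘ x)).charpolyRev.coeff (k + 1) =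
      -(X * (∑ i ∈ Finset.range k, X ^ i) * (Finset.univ.val.map (C ∘ x)).esymm (k + 1)) := by
    refine (C_1 (R := R) ▸ monic_X_sub_C (1 : R)).isRegular.left ?_
    change (X - 1) * _ = (X - 1) * _
    rw [sub_one_mul_coeff_charpolyRev_ascMatrix]
    linear_combination X * (Finset.univ.val.map (C ∘ x)).esymm (k + 1) * mul_geom_sum (X : R[X]) k
  have h := congrArg (evalRingHom t) hgeneric
  rw [← coeff_map, ← charpolyRev_map, map_ascMatrix] at h
  simpa [Function.comp_def, Finset.esymm_map_val, eval_finsetSum, eval_prod] using h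

end AscentMatrix

section RestrictVars

variable {σ R : Type*} [DecidableEq σ] [CommSemiring R]

/-- The substitution that sets the variables with index outside `s` to zero. -/
noncomputable def restrictVars (s : Finset σ) : MvPowerSeries σ R →+* MvPowerSeries σ R :=
  MvPowerSeries.rescale fun i => if i ∈ s then 1 else 0

theorem coeff_restrictVars (s : Finset σ) (f : MvPowerSeries σ R) (m : σ →₀ ℕ) :
    MvPowerSeries.coeff m (restrictVars s f) =
      if m.support ⊆ s then MvPowerSeries.coeff m f else 0 := by
  rw [restrictVars, MvPowerSeries.coeff_rescale, Finsupp.prod]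
  split_ifs with h
  · rw [Finset.prod_eq_one fun i hi => by rw [if_pos (h hi), one_pow], one_mul]
  · obtain ⟨i, hi, his⟩ := Finset.not_subset.mp h
    rw [Finset.prod_eq_zero hi (by rw [if_neg his, zero_pow (Finsupp.mem_support_iff.mp hi)]),
      zero_mul]

theorem restrictVars_C (s : Finset σ) (r : R) :
    restrictVars s (MvPowerSeries.C r) = MvPowerSeries.C r := by
  ext1 m
  by_cases h : m = 0 <;> simp [coeff_restrictVars, MvPowerSeries.coeff_C, h]

theorem eq_of_forall_map_restrictVars_eq {f g : PowerSeries (MvPowerSeries σ R)}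
    (h : ∀ s, PowerSeries.map (restrictVars s) f = PowerSeries.map (restrictVars s) g) :
    f = g := by
  ext n m : 2
  simpa [coeff_restrictVars] using
    congrArg (fun p => MvPowerSeries.coeff m (PowerSeries.coeff n p)) (h m.support)

theorem coeff_prod_X {ι : Type*} (S : Finset ι) (κ : ι → σ) (m : σ →₀ ℕ) :
    MvPowerSeries.coeff m (∏ i ∈ S, (MvPowerSeries.X (κ i) : MvPowerSeries σ R)) =
      if m = ∑ i ∈ S, Finsupp.single (κ i) 1 then 1 else 0 := by
  simp only [MvPowerSeries.X, MvPowerSeries.prod_monomial, Finset.prod_const_one,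
    MvPowerSeries.coeff_monomial]

end RestrictVars

namespace ChromQSym

section ElementarySymmetric

theorem support_sum_single (S : Finset ℕ+) :
    (∑ i ∈ S, Finsupp.single i 1 : ℕ+ →₀ ℕ).support = S := by
  ext j
  simp [Finsupp.finsetSum_apply, Finsupp.single_apply]

theorem sum_single_injective :
    Function.Injective fun S : Finset ℕ+ => (∑ i ∈ S, Finsupp.single i 1 : ℕ+ →₀ ℕ) :=
  Function.LeftInverse.injective (g := Finsupp.support) support_sum_single

theorem restrictVars_esymm (s : Finset ℕ+) (k : ℕ) :
    restrictVars s (esymm k) = (s.val.map MvPowerSeries.X).esymm k := by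
  ext1 m
  rw [Finset.esymm_map_val, coeff_restrictVars, map_sum, MvPowerSeries.coeff_apply, esymm,
    Finset.sum_congr rfl fun S _ => coeff_prod_X S (fun i => i) m]
  by_cases h : ∃ S : Finset ℕ+, S.card = k ∧ m = ∑ i ∈ S, Finsupp.single i 1
  · rw [if_pos h]
    obtain ⟨S, hS, rfl⟩ := h
    simp [sum_single_injective.eq_iff, support_sum_single, Finset.mem_powersetCard, hS]
  · rw [if_neg h, ite_self, Finset.sum_eq_zero]
    exact fun S hS => if_neg fun hm => h ⟨S, (Finset.mem_powersetCard.mp hS).2, hm⟩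

end ElementarySymmetric

section Colorings

variable {V : Type} [Fintype V]

theorem support_monoExp_subset_iff (κ : V → ℕ+) (s : Finset ℕ+) :
    (monoExp κ).support ⊆ s ↔ ∀ v, κ v ∈ s := by
  simp [Finset.subset_iff, monoExp, Finsupp.finsetSum_apply, Finsupp.single_apply]

open Classical in
theorem restrictVars_chromQSym [DecidableEq V] (s : Finset ℕ+) (G : Digraph V) :
    restrictVars s (chromQSym G) = ∑ κ : V → s,
      if IsProper G (fun v => (κ v : ℕ+)) then
        tVar ^ asc G (fun v => (κ v : ℕ+)) * ∏ v, MvPowerSeries.X (κ v : ℕ+) else 0 := by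
  ext1 m
  have hterm (κ : V → ℕ+) : MvPowerSeries.coeff m
      (if IsProper G κ then tVar ^ asc G κ * ∏ v, MvPowerSeries.X (κ v) else 0) =
      if IsProper G κ ∧ monoExp κ = m then (X : ℚ[X]) ^ asc G κ else 0 := by
    rw [apply_ite (MvPowerSeries.coeff m), map_zero, tVar, ← map_pow, MvPowerSeries.coeff_C_mul,
      coeff_prod_X, ← monoExp, mul_ite, mul_one, mul_zero, ← ite_and]
    simp only [eq_comm]
  rw [map_sum, Finset.sum_congr rfl fun κ _ => hterm fun v => κ v, ← Finset.sum_filter,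
    coeff_restrictVars, MvPowerSeries.coeff_apply, chromQSym]
  split_ifs with hm
  · symm
    refine Finset.sum_bij (fun κ _ v => (κ v : ℕ+)) (fun κ hκ => ?_)
      (fun κ _ κ' _ h => funext fun v => Subtype.ext (congrFun h v)) (fun κ hκ => ?_)
      fun _ _ => rfl
    · exact (mem_properColorings G m _).2 (Finset.mem_filter.mp hκ).2
    · obtain ⟨hproper, rfl⟩ := (mem_properColorings G m κ).1 hκ
      exact ⟨fun v => ⟨κ v, (support_monoExp_subset_iff κ s).1 hm v⟩, by simpa using hproper, rfl⟩
  · rw [Finset.filter_false_of_mem, Finset.sum_empty]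
    rintro κ - ⟨-, rfl⟩
    exact hm ((support_monoExp_subset_iff _ s).2 fun v => (κ v).2)

variable {G : Digraph V} {σ : Equiv.Perm V}

omit [Fintype V] in
theorem isProper_iff_forall_ne_apply (hσ : ∀ v, σ v ≠ v) (hG : ∀ u v, G.Adj u v ↔ v = σ u)
    (κ : V → ℕ+) : IsProper G κ ↔ ∀ v, κ v ≠ κ (σ v) := by
  simp only [IsProper, Digraph.toSimpleGraphInclusive, SimpleGraph.fromRel_adj, hG]
  constructor
  · exact fun h v => h v (σ v) ⟨(hσ v).symm, Or.inl rfl⟩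
  · rintro h u v ⟨-, rfl | rfl⟩
    · exact h u
    · exact (h v).symm

theorem asc_eq_card_lt_apply (hG : ∀ u v, G.Adj u v ↔ v = σ u) (κ : V → ℕ+) :
    asc G κ = (Finset.univ.filter fun v => κ v < κ (σ v)).card := by
  classical
  refine Finset.card_nbij' Prod.fst (fun v => (v, σ v)) ?_ ?_ ?_ ?_ <;>
    simp +contextual [Set.MapsTo, Set.LeftInvOn, hG]

open Classical in
theorem prod_ascMatrix_apply {R : Type*} [CommSemiring R] (hσ : ∀ v, σ v ≠ v)
    (hG : ∀ u v, G.Adj u v ↔ v = σ u) (t : R) (x : ℕ+ → R) (κ : V → ℕ+) :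
    ∏ v, ascMatrix t x (κ v) (κ (σ v)) =
      if IsProper G κ then t ^ asc G κ * ∏ v, x (κ v) else 0 := by
  rw [isProper_iff_forall_ne_apply hσ hG]
  split_ifs with h
  · have hstep (v : V) : ascMatrix t x (κ v) (κ (σ v)) =
        x (κ (σ v)) * if κ v < κ (σ v) then t else 1 := by
      rcases (h v).lt_or_gt with hlt | hgt
      · simp [ascMatrix, hlt]
      · simp [ascMatrix, hgt, hgt.not_gt]
    simp only [hstep, Finset.prod_mul_distrib, ← Finset.prod_filter, Finset.prod_const,
      asc_eq_card_lt_apply hG, Equiv.prod_comp σ fun v => x (κ v)]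
    exact mul_comm _ _
  · push Not at h
    obtain ⟨v, hv⟩ := h
    exact Finset.prod_eq_zero (Finset.mem_univ v) (by simp [ascMatrix, hv])

theorem directedCycle_adj_iff (n : ℕ) (i j : Fin (n + 2)) :
    (directedCycle (n + 2)).Adj i j ↔ j = i + 1 := by
  change (i.val + 1 = j.val ∨ (i.val + 1 = n + 2 ∧ j.val = 0)) ↔ _
  rw [Fin.ext_iff, Fin.val_add_one]
  split_ifs with h
  · have := j.isLt
    rw [h, Fin.val_last]
    omega
  · have : i.val ≠ n + 1 := fun h' => h (Fin.ext h')
    omega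

/-- The transfer matrix of the colorings with colors in `s`, over `ℚ[t]⟦x₁, x₂, …⟧`. -/
noncomputable def transferMatrix (s : Finset ℕ+) : Matrix s s (MvPowerSeries ℕ+ ℚ[X]) :=
  ascMatrix tVar fun j => MvPowerSeries.X (j : ℕ+)

theorem restrictVars_chromQSym_directedCycle (s : Finset ℕ+) (n : ℕ) :
    restrictVars s (chromQSym (directedCycle (n + 2))) = (transferMatrix s ^ (n + 2)).trace := by
  rw [trace_pow_succ_eq_sum_closed_walks, restrictVars_chromQSym]
  refine Finset.sum_congr rfl fun κ _ => Eq.symm ?_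
  exact prod_ascMatrix_apply (σ := Equiv.addRight 1) (by simp) (directedCycle_adj_iff n) tVar
    MvPowerSeries.X fun i => (κ i : ℕ+)

end Colorings

section GeneratingFunctions

open scoped PowerSeries

theorem coeff_genFrom2 (a : ℕ → MvPowerSeries ℕ+ ℚ[X]) (n : ℕ) :
    PowerSeries.coeff n (genFrom2 a) = if 2 ≤ n then a n else 0 :=
  PowerSeries.coeff_mk _ _

theorem genFrom2_natCast_mul (a : ℕ → MvPowerSeries ℕ+ ℚ[X]) :
    genFrom2 (fun n => n * a n) = PowerSeries.X * d⁄dX _ (genFrom2 a) := by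
  ext1 n
  cases n with
  | zero => simp [coeff_genFrom2]
  | succ n =>
    rw [PowerSeries.coeff_succ_X_mul, PowerSeries.coeff_derivative, coeff_genFrom2, coeff_genFrom2,
      ite_mul, zero_mul, mul_comm, Nat.cast_succ]

theorem isUnit_one_sub_C_mul_genFrom2 (c : MvPowerSeries ℕ+ ℚ[X])
    (a : ℕ → MvPowerSeries ℕ+ ℚ[X]) : IsUnit (1 - PowerSeries.C c * genFrom2 a) := by
  rw [PowerSeries.isUnit_iff_constantCoeff]
  have hzero : PowerSeries.constantCoeff (genFrom2 a) = 0 := by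
    rw [← PowerSeries.coeff_zero_eq_constantCoeff_apply, coeff_genFrom2, if_neg two_pos.not_ge]
  simp [hzero]

/-- The denominator `1 - t ∑_{k ≥ 2} [k-1]_t e_k z^k`. -/
noncomputable def cycleDenom : PowerSeries (MvPowerSeries ℕ+ ℚ[X]) :=
  1 - PowerSeries.C tVar * genFrom2 fun k => tInt (k - 1) * esymm k

theorem map_restrictVars_cycleDenom (s : Finset ℕ+) :
    PowerSeries.map (restrictVars s) cycleDenom = (transferMatrix s).charpolyRev := by
  have htVar : restrictVars s tVar = tVar := restrictVars_C s X
  ext1 k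
  rw [PowerSeries.coeff_map, cycleDenom, map_sub, PowerSeries.coeff_C_mul, coeff_genFrom2,
    Polynomial.coeff_coe]
  match k with
  | 0 => simp [Polynomial.coeff_zero_eq_eval_zero]
  | k + 1 =>
    have hesymm : restrictVars s (esymm (k + 1)) =
        (Finset.univ.val.map fun j : s => MvPowerSeries.X (j : ℕ+)).esymm (k + 1) := by
      rw [restrictVars_esymm]
      exact congrArg (Multiset.esymm · _) (s.val.attach_map_val' MvPowerSeries.X).symm
    rw [transferMatrix, coeff_succ_charpolyRev_ascMatrix, ← hesymm, PowerSeries.coeff_one,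
      if_neg k.succ_ne_zero]
    cases k with
    | zero => simp
    | succ k => simp [tInt, htVar, mul_assoc]

theorem map_restrictVars_genFrom2_chromQSym (s : Finset ℕ+) :
    PowerSeries.map (restrictVars s) (genFrom2 fun n => chromQSym (directedCycle n)) =
      PowerSeries.X * PowerSeries.mk fun n => (transferMatrix s ^ (n + 1)).trace := by
  ext1 n
  rw [PowerSeries.coeff_map, coeff_genFrom2]
  match n with
  | 0 => simp
  | 1 => simp [PowerSeries.coeff_succ_X_mul, Matrix.trace, transferMatrix, ascMatrix]
  | n + 2 => simp [PowerSeries.coeff_succ_X_mul, restrictVars_chromQSym_directedCycle]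

theorem genFrom2_chromQSym_mul_cycleDenom :
    (genFrom2 fun n => chromQSym (directedCycle n)) * cycleDenom =
      -(PowerSeries.X * d⁄dX _ cycleDenom) := by
  refine eq_of_forall_map_restrictVars_eq fun s => ?_
  rw [map_mul, map_neg, map_mul, PowerSeries.map_X, map_derivative, map_restrictVars_cycleDenom,
    map_restrictVars_genFrom2_chromQSym, mul_assoc, mk_trace_pow_succ_mul_charpolyRev, mul_neg]

theorem neg_X_mul_derivative_cycleDenom :
    -(PowerSeries.X * d⁄dX _ cycleDenom) = PowerSeries.C tVar * genFrom2 fun k =>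
      (k : MvPowerSeries ℕ+ ℚ[X]) * tInt (k - 1) * esymm k := by
  simp only [mul_assoc, genFrom2_natCast_mul fun k => tInt (k - 1) * esymm k]
  simp [cycleDenom, Derivation.leibniz, mul_left_comm]

end GeneratingFunctions

end ChromQSym

theorem theorem6p1 :
    IsUnit (1 - PowerSeries.C ChromQSym.tVar *
      ChromQSym.genFrom2 fun k => ChromQSym.tInt (k - 1) * ChromQSym.esymm k) ∧
    (ChromQSym.genFrom2 fun n => ChromQSym.chromQSym (ChromQSym.directedCycle n)) =
      (PowerSeries.C ChromQSym.tVar * ChromQSym.genFrom2 fun k =>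
          (k : MvPowerSeries ℕ+ ℚ[X]) * ChromQSym.tInt (k - 1) * ChromQSym.esymm k) *
        Ring.inverse (1 - PowerSeries.C ChromQSym.tVar *
          ChromQSym.genFrom2 fun k => ChromQSym.tInt (k - 1) * ChromQSym.esymm k) := by
  have hunit := ChromQSym.isUnit_one_sub_C_mul_genFrom2 ChromQSym.tVar
    fun k => ChromQSym.tInt (k - 1) * ChromQSym.esymm k
  refine ⟨hunit, (Ring.eq_mul_inverse_iff_mul_eq _ _ _ hunit).2 ?_⟩
  exact ChromQSym.genFrom2_chromQSym_mul_cycleDenom.trans ChromQSym.neg_X_mul_derivative_cycleDenom
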